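/- Fix a finitary algebraic signature and an algebra $\mathbf{L}$ in it. All algebras are in this signature; subalgebras may be empty if the signature has no constants; $\mathbf{L}$ carries the discrete topology. **Hypotheses.** Suppose that $\mathbf{L}$ has more than one element, that the empty set is not a subalgebra of $\mathbf{L}$, and that every homomorphism $h\colon \mathbf{A}\to\mathbf{L}$ from a subalgebra $\mathbf{A}\le\mathbf{L}$ is the inclusion map. Suppose further that $\mathbf{L}$ has a majority term, i.e. a ternary term $m$ with $m(a,a,b)=m(a,b,a)=m(b,a,a)=a$ for all $a,b\in\mathbf{L}$, and that every subalgebra of $\mathbf{L}\times\mathbf{L}$ is either a subdiagonal $\{(c,c) : c\in\mathbf{C}\}$ for some $\mathbf{C}\le\mathbf{L}$ or a product $\mathbf{C}_1\times\mathbf{C}_2$ for some $\mathbf{C}_1,\mathbf{C}_2\le\mathbf{L}$. **Algebras.** An algebra $\mathbf{A}$ is a *finitely valued $\mathbf{L}$-algebra* if there is an embedding of $\mathbf{A}$ into a power $\mathbf{L}^X$ ($X$ a set) sending each element of $\mathbf{A}$ to a function $X\to\mathbf{L}$ of finite range. Morphisms are homomorphisms. **Spaces.** A *unary $\mathbf{L}$-constrained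 space* is a topological space $X$ together with a subalgebra $\mathbf{A}_I\le\mathbf{L}^I$ for each $I\subseteq X$ with $|I|\le 1$, and an equivalence relation $\approx$ on $X$, closed in $X\times X$, such that, writing $\mathbf{A}_x=\{a\in\mathbf{L} : (x\mapsto a)\in\mathbf{A}_{\{x\}}\}$: 1. (subdirectness) $\mathbf{A}_J=\{f|_J : f\in\mathbf{A}_I\}$ whenever $J\subseteq I\subseteq X$ and $|I|\le 1$; 2. (continuity) each $f\in\mathbf{A}_I$ is continuous, and $\{x\in X : a\in\mathbf{A}_x\}$ is open for each $a\in\mathbf{L}$; 3. if $x\not\approx y$, then there are $a\in\mathbf{A}_x$ and $b\in\mathbf{A}_y$ with $a\ne b$. It is *separated* if $\approx$ is equality, and *Stone* if $X$ is compact, Hausdorff and has a basis of clopen sets. A morphism from $\langle X,(\mathbf{A}_I)_I,\approx_X\rangle$ to $\langle Y,(\mathbf{B}_J)_J,\approx_Y\rangle$ (a *continuous $\mathbf{L}$-constrained map*) is a continuous map $\phi\colon X\to Y$ such that $g\in\mathbf{B}_{\phi[I]}$ implies $g\circ\phi|_I\in\mathbf{A}_I$ for all $I\subseteq X$ with $|I|\le1$,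 and $x\approx_X y$ implies $\phi(x)\approx_Y\phi(y)$. **Conclusion.** There is a dual equivalence between the category of finitely valued $\mathbf{L}$-algebras and the category of Stone separated unary $\mathbf{L}$-constrained spaces. -/

import Mathlib

open CategoryTheory FirstOrder

universe u v w w'

namespace LDuality

/-! ### Algebras

An algebraic signature is a first-order language `S` without relation symbols
(`[S.IsAlgebraic]`), an algebra is an `S`-structure, a subalgebra is an `S.Substructure`
(possibly empty if `S` has no constant symbols), a homomorphism is an `A →[S] B`. -/

/-- The power `A ^ X` of an algebra, with pointwise operations. -/
instance powerStructure {S : FirstOrder.Language.{u, v}} (X : Type w) (A : Type w') [S.Structure A] :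
    S.Structure (X → A) where
  funMap f a := fun x => FirstOrder.Language.Structure.funMap f fun i => a i x
  RelMap r a := ∀ x, FirstOrder.Language.Structure.RelMap r fun i => a i x

/-- The binary product `A × B` of algebras, with componentwise operations. -/
instance prodStructure {S : FirstOrder.Language.{u, v}} (A : Type w) (B : Type w') [S.Structure A]
    [S.Structure B] : S.Structure (A × B) where
  funMap f a :=
    (FirstOrder.Language.Structure.funMap f fun i => (a i).1, FirstOrder.Language.Structure.funMap f fun i => (a i).2)
  RelMap r a :=
    FirstOrder.Language.Structure.RelMap r (fun i => (a i).1) ∧ FirstOrder.Language.Structure.RelMap r fun i => (a i).2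

/-- Every partial endomorphism of `L` (a homomorphism `A → L` with `A ≤ L`) is an inclusion. -/
def OnlyTrivialPartialEndomorphisms (S : FirstOrder.Language.{u, v}) (L : Type w) [S.Structure L] : Prop :=
  ∀ (A : S.Substructure L) (h : A →[S] L) (a : A), h a = a

/-- The empty set is not a subalgebra of `L`. -/
def NoEmptySubalgebra (S : FirstOrder.Language.{u, v}) (L : Type w) [S.Structure L] : Prop :=
  ∀ A : S.Substructure L, (A : Set L).Nonempty

/-- The ternary term `m` is a majority term on `L`. -/
def IsMajorityTerm {S : FirstOrder.Language.{u, v}} (L : Type w) [S.Structure L]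
    (m : S.Term (Fin 3)) : Prop :=
  ∀ a b : L, m.realize ![a, a, b] = a ∧ m.realize ![a, b, a] = a ∧ m.realize ![b, a, a] = a

/-- `D` is the diagonal `Δ_C` of some subalgebra `C ≤ L`. -/
def IsSubdiagonal {S : FirstOrder.Language.{u, v}} {L : Type w} [S.Structure L]
    (D : S.Substructure (L × L)) : Prop :=
  ∃ C : S.Substructure L, (D : Set (L × L)) = {p | p.1 ∈ C ∧ p.2 = p.1}

/-- `D` is `C₁ × C₂` for some subalgebras `C₁, C₂ ≤ L`. -/
def IsProductSubalgebra {S : FirstOrder.Language.{u, v}} {L : Type w} [S.Structure L]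
    (D : S.Substructure (L × L)) : Prop :=
  ∃ C₁ C₂ : S.Substructure L, (D : Set (L × L)) = (C₁ : Set L) ×ˢ (C₂ : Set L)

/-- `L × L` only has subdiagonal or product subalgebras. -/
def OnlySubdiagonalOrProductSubalgebras (S : FirstOrder.Language.{u, v}) (L : Type w) [S.Structure L] :
    Prop :=
  ∀ D : S.Substructure (L × L), IsSubdiagonal D ∨ IsProductSubalgebra D

/-- Algebras in the signature `S`, on carriers in `Type w`. -/
structure Alg (S : FirstOrder.Language.{u, v}) : Type (max u v (w + 1)) where
  carrier : Type w
  [str : S.Structure carrier]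

attribute [instance] Alg.str

/-- The category of algebras in the signature `S` and homomorphisms. -/
instance Alg.category (S : FirstOrder.Language.{u, v}) : Category (Alg.{u, v, w} S) where
  Hom A B := A.carrier →[S] B.carrier
  id A := FirstOrder.Language.Hom.id S A.carrier
  comp f g := FirstOrder.Language.Hom.comp g f

/-- `A` is a finitely valued `L`-algebra: it embeds into a power `L ^ X` in such a way that each
of its elements is sent to a function `X → L` of finite range. -/
def IsFinitelyValued {S : FirstOrder.Language.{u, v}} (L : Type w) [S.Structure L] :
    ObjectProperty (Alg.{u, v, w} S) :=
  fun A => ∃ (X : Type w) (ρ : A.carrier ↪[S] (X → L)), ∀ a, (Set.range (ρ a)).Finite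

/-- The category of finitely valued `L`-algebras and homomorphisms. -/
abbrev FinitelyValuedAlg (S : FirstOrder.Language.{u, v}) (L : Type w) [S.Structure L] :=
  (IsFinitelyValued (S := S) L).FullSubcategory

/-! ### Unary `L`-constrained spaces

The algebra `L` carries the discrete topology, so a function into `L` is continuous if and only if
it is locally constant. -/

/-- A family of unary constraints on `X`: a subalgebra `A_I ≤ L ^ I` for each `I ⊆ X` with at
most one element. -/
abbrev UnaryConstraints (S : FirstOrder.Language.{u, v}) (L : Type w) [S.Structure L] (X : Type w') :=
  ∀ I : Set X, I.Subsingleton → S.Substructure (I → L)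

namespace UnaryConstraints

variable {S : FirstOrder.Language.{u, v}} {L : Type w} [S.Structure L] {X : Type w'}

/-- `A_J = π_J[A_I]` whenever `J ⊆ I`. -/
def IsSubdirect (A : UnaryConstraints S L X) : Prop :=
  ∀ (I J : Set X) (hI : I.Subsingleton) (hJ : J.Subsingleton) (h : J ⊆ I) (g : J → L),
    g ∈ A J hJ ↔ ∃ f ∈ A I hI, ∀ x : J, g x = f (Set.inclusion h x)

/-- The set `A_x` of those `a : L` for which the function `x ↦ a` belongs to `A_{x}`. -/
def fiber (A : UnaryConstraints S L X) (x : X) : Set L :=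
  {a | (fun _ => a) ∈ A {x} Set.subsingleton_singleton}

/-- The constraints consist of continuous functions, and for each `a` the set of those `x` with
`a ∈ A_x` is open. -/
def IsContinuous [TopologicalSpace X] (A : UnaryConstraints S L X) : Prop :=
  (∀ (I : Set X) (hI : I.Subsingleton), ∀ f ∈ A I hI, IsLocallyConstant f) ∧
    ∀ a : L, IsOpen {x : X | a ∈ A.fiber x}

theorem mem_congr (A : UnaryConstraints S L X) {I J : Set X} (h : I = J) (hI : I.Subsingleton)
    (hJ : J.Subsingleton) (g : I → L) (hg : g ∈ A I hI) :
    (fun x : J => g ⟨x, h ▸ x.2⟩) ∈ A J hJ := by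
  subst h
  exact hg

end UnaryConstraints

/-- A unary `L`-constrained space: a topological space with a continuous subdirect family of
unary constraints and a closed equivalence relation `≈` such that `x ≉ y` implies that there are
`a ∈ A_x` and `b ∈ A_y` with `a ≠ b`. -/
structure UnarySpace (S : FirstOrder.Language.{u, v}) (L : Type w) [S.Structure L] :
    Type (max u v (w + 1)) where
  carrier : Type w
  [top : TopologicalSpace carrier]
  constraint : UnaryConstraints S L carrier
  subdirect : constraint.IsSubdirect
  continuous : constraint.IsContinuous
  rel : Setoid carrier
  closed : IsClosed {p : carrier × carrier | rel p.1 p.2}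
  distinguish : ∀ x y, ¬ rel x y → ∃ a ∈ constraint.fiber x, ∃ b ∈ constraint.fiber y, a ≠ b

attribute [instance] UnarySpace.top

/-- A continuous `L`-constrained map between unary `L`-constrained spaces. -/
@[ext]
structure UnarySpace.Hom {S : FirstOrder.Language.{u, v}} {L : Type w} [S.Structure L]
    (X Y : UnarySpace S L) : Type w where
  toFun : X.carrier → Y.carrier
  continuous_toFun : Continuous toFun
  map_constraint : ∀ (I : Set X.carrier) (hI : I.Subsingleton) (g : toFun '' I → L),
    g ∈ Y.constraint (toFun '' I) (hI.image toFun) →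
      (fun x : I => g ⟨toFun x, Set.mem_image_of_mem toFun x.2⟩) ∈ X.constraint I hI
  map_rel : ∀ x y, X.rel x y → Y.rel (toFun x) (toFun y)

/-- The identity map. -/
def UnarySpace.Hom.id {S : FirstOrder.Language.{u, v}} {L : Type w} [S.Structure L] (X : UnarySpace S L) :
    UnarySpace.Hom X X where
  toFun x := x
  continuous_toFun := continuous_id
  map_constraint I hI g hg := X.constraint.mem_congr (by simp) _ hI g hg
  map_rel _ _ h := h

/-- The composite of two maps. -/
def UnarySpace.Hom.comp {S : FirstOrder.Language.{u, v}} {L : Type w} [S.Structure L]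
    {X Y Z : UnarySpace S L} (φ : UnarySpace.Hom X Y) (ψ : UnarySpace.Hom Y Z) :
    UnarySpace.Hom X Z where
  toFun x := ψ.toFun (φ.toFun x)
  continuous_toFun := ψ.continuous_toFun.comp φ.continuous_toFun
  map_constraint I hI g hg :=
    φ.map_constraint I hI _ (ψ.map_constraint (φ.toFun '' I) (hI.image _) _
      (Z.constraint.mem_congr (Set.image_image ψ.toFun φ.toFun I).symm _ _ g hg))
  map_rel x y h := ψ.map_rel _ _ (φ.map_rel x y h)

/-- The category of unary `L`-constrained spaces and continuous `L`-constrained maps. -/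
instance UnarySpace.category (S : FirstOrder.Language.{u, v}) (L : Type w) [S.Structure L] :
    Category (UnarySpace S L) where
  Hom := UnarySpace.Hom
  id := UnarySpace.Hom.id
  comp := UnarySpace.Hom.comp

/-- A Stone space: compact, Hausdorff, with a basis of clopen sets. -/
def IsStone (X : Type w) [TopologicalSpace X] : Prop :=
  CompactSpace X ∧ T2Space X ∧ TopologicalSpace.IsTopologicalBasis {U : Set X | IsClopen U}

/-- The space is topologically a Stone space, and it is separated: `≈` is equality. -/
def IsStoneSeparated (S : FirstOrder.Language.{u, v}) (L : Type w) [S.Structure L] :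
    ObjectProperty (UnarySpace S L) :=
  fun X => IsStone X.carrier ∧ ∀ x y, X.rel x y ↔ x = y

/-- The category of Stone separated unary `L`-constrained spaces and continuous `L`-constrained
maps. -/
abbrev StoneUnarySpace (S : FirstOrder.Language.{u, v}) (L : Type w) [S.Structure L] :=
  (IsStoneSeparated S L).FullSubcategory

end LDuality

namespace LDuality

/-! ### Subalgebras of `L` and independence of homomorphisms -/

section Algebra

open FirstOrder.Language FirstOrder.Language.Structure

variable {S : FirstOrder.Language.{u, v}} {L : Type w} [S.Structure L]

/-! The dual of an algebra `A` is the space of homomorphisms `A → L`, with the range of `h` as the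
fiber at `h`; a space gives back the algebra of its locally constant sections.

The hypotheses act through two facts: `L` has no one-element subalgebra, and two distinct
homomorphisms into `L` take their values independently. With the majority term this gives a
Baker–Pixley argument over a compact index space: whatever can be solved at two homomorphisms at a
time can be patched, by compactness, into a global solution.

The patching has two outcomes. By `exists_eq_of_separating`, a compact family of homomorphisms that
separates points contains every nonconstant homomorphism; this makes the dual of `A` compact and
makes every homomorphism from a section algebra an evaluation. By `exists_eq_section`, every locally
constant section over the dual is evaluation at an element; this gives fullness. -/

theorem NoEmptySubalgebra.nonempty_constants (h : NoEmptySubalgebra S L) :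
    Nonempty S.Constants := by
  by_contra hc
  rw [not_nonempty_iff] at hc
  -- Without constants, the empty set is vacuously closed under all operations.
  let A : S.Substructure L :=
    { carrier := ∅
      fun_mem := fun {n} f x hx => by
        cases n with
        | zero => exact (hc.false f).elim
        | succ n => exact (hx 0).elim }
  obtain ⟨x, hx⟩ := h A
  exact hx

/-- If `B` were `{x}`, the constant map with value `x` would be an endomorphism of `L` other than
the identity. -/
theorem OnlyTrivialPartialEndomorphisms.exists_mem_ne [S.IsAlgebraic] [Nontrivial L]
    (h : OnlyTrivialPartialEndomorphisms S L) {B : S.Substructure L} (hB : (B : Set L).Nonempty)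
    (x : L) : ∃ y ∈ B, y ≠ x := by
  by_contra! hx
  have hxB : x ∈ B := by
    obtain ⟨b, hb⟩ := hB
    exact hx b hb ▸ hb
  let k : (⊤ : S.Substructure L) →[S] L :=
    { toFun := fun _ => x
      map_fun' := fun f _ => (hx _ (B.fun_mem f (fun _ => x) fun _ => hxB)).symm
      map_rel' := fun r => isEmptyElim r }
  obtain ⟨y, hy⟩ := exists_ne x
  exact hy (h ⊤ k ⟨y, trivial⟩).symm

/-- The projection of a power of an algebra to a coordinate. -/
def evalHom (S : FirstOrder.Language.{u, v}) {X : Type w'} (L : Type w) [S.Structure L] (x : X) :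
    (X → L) →[S] L where
  toFun f := f x
  map_fun' _ _ := rfl
  map_rel' _ _ h := h x

/-- The homomorphism to a product with given components. -/
def pairHom {A : Type w'} [S.Structure A] (g h : A →[S] L) : A →[S] (L × L) where
  toFun a := (g a, h a)
  map_fun' f x := Prod.ext (g.map_fun f x) (h.map_fun f x)
  map_rel' r x hx := ⟨g.map_rel r x hx, h.map_rel r x hx⟩

/-- The image of `A` in `L × L` under `(g, h)` is not subdiagonal because `g ≠ h`, so it is a
product and the two coordinates can be prescribed separately. -/
theorem OnlySubdiagonalOrProductSubalgebras.exists_apply_eq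
    (H : OnlySubdiagonalOrProductSubalgebras S L) {A : Type w'} [S.Structure A] {g h : A →[S] L}
    (hne : g ≠ h) (a b : A) : ∃ d, g d = g a ∧ h d = h b := by
  have hmem : ∀ d, (g d, h d) ∈ ((pairHom g h).range : Set (L × L)) := fun d => Hom.mem_range_self (pairHom g h) d
  rcases H (pairHom g h).range with ⟨C, hC⟩ | ⟨C₁, C₂, hC⟩
  · refine (hne (Hom.ext fun d => ?_)).elim
    have := hmem d
    rw [hC] at this
    exact this.2.symm
  · have h1 := hmem a
    have h2 := hmem b
    rw [hC] at h1 h2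
    have h3 : (g a, h b) ∈ ((pairHom g h).range : Set (L × L)) := by
      rw [hC]
      exact ⟨h1.1, h2.2⟩
    obtain ⟨d, hd⟩ := Hom.mem_range.1 h3
    exact ⟨d, congrArg Prod.fst hd, congrArg Prod.snd hd⟩

theorem hom_realize_three {A : Type w'} [S.Structure A] (m : S.Term (Fin 3)) (h : A →[S] L)
    (a b c : A) : h (m.realize ![a, b, c]) = m.realize ![h a, h b, h c] := by
  rw [← HomClass.realize_term]
  congr 1
  ext i
  fin_cases i <;> rfl

end Algebra

/-! ### Baker–Pixley interpolation over a compact space -/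

section Interpolation

open FirstOrder.Language Topology Filter

variable {S : FirstOrder.Language.{u, v}} {L : Type w} [S.Structure L] {A : Type w'} [S.Structure A]
  {X : Type*} [TopologicalSpace X]

/-- If `b x = a x` can be achieved together with `h b = d` at each single point `x` of a compact
set, then it can be achieved at all its points simultaneously. -/
theorem exists_eqOn_of_isCompact {m : S.Term (Fin 3)} (hm : IsMajorityTerm L m)
    {e : X → (A →[S] L)} (he : ∀ a, IsLocallyConstant fun x => e x a) (h : A →[S] L) {d : L} (a : A)
    {V : Set X} (hV : IsCompact V) (hd : ∃ b, h b = d)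
    (hp : ∀ x ∈ V, ∃ b, h b = d ∧ e x b = e x a) :
    ∃ b, h b = d ∧ ∀ x ∈ V, e x b = e x a := by
  refine hV.induction_on (p := fun U => ∃ b, h b = d ∧ ∀ x ∈ U, e x b = e x a) ?_ ?_ ?_ ?_
  · obtain ⟨b, hb⟩ := hd
    exact ⟨b, hb, by simp⟩
  · rintro s t hst ⟨b, hb, hb'⟩
    exact ⟨b, hb, fun x hx => hb' x (hst hx)⟩
  · rintro s t ⟨b, hb, hb'⟩ ⟨c, hc, hc'⟩
    -- Each requirement is met by two of the three arguments: `h` by `b` and `c`, points of `s` by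
    -- `b` and `a`, points of `t` by `c` and `a`.
    refine ⟨m.realize ![b, c, a], ?_, ?_⟩
    · rw [hom_realize_three, hb, hc, (hm _ _).1]
    · rintro x (hx | hx)
      · rw [hom_realize_three, hb' x hx, (hm _ _).2.1]
      · rw [hom_realize_three, hc' x hx, (hm _ _).2.2]
  · intro x hx
    obtain ⟨b, hb, hb'⟩ := hp x hx
    refine ⟨{y | e y b = e y a}, mem_nhdsWithin_of_mem_nhds ?_, b, hb, fun _ hy => hy⟩
    filter_upwards [(he a).eventually_eq x, (he b).eventually_eq x] with y h1 h2
    rw [h1, h2, hb']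

theorem exists_eq_of_separating [CompactSpace X] {m : S.Term (Fin 3)} (hm : IsMajorityTerm L m)
    (hbin : OnlySubdiagonalOrProductSubalgebras S L) {e : X → (A →[S] L)}
    (he : ∀ a, IsLocallyConstant fun x => e x a) (hinj : ∀ a b, (∀ x, e x a = e x b) → a = b)
    (h : A →[S] L) (hne : ∃ a b, h a ≠ h b) : ∃ x, e x = h := by
  by_contra! hx
  obtain ⟨a, b, hab⟩ := hne
  -- If `h` is no `e x`, some `c` agrees with `a` at every point but has `h c = h b`. Separation
  -- forces `c = a`, contradicting `h a ≠ h b`.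
  obtain ⟨c, hc, hc'⟩ := exists_eqOn_of_isCompact hm he h a isCompact_univ ⟨b, rfl⟩ fun x _ =>
    hbin.exists_apply_eq (hx x).symm b a
  exact hab (hinj c a (fun x => hc' x trivial) ▸ hc)

/-- The set where an element agrees with `f` is enlarged: `step` adds one point, `join` unites two
agreement sets, and compactness makes finitely many unions suffice. -/
theorem exists_eq_section [CompactSpace X] [Nonempty A] {m : S.Term (Fin 3)}
    (hm : IsMajorityTerm L m) (hbin : OnlySubdiagonalOrProductSubalgebras S L) {e : X → (A →[S] L)}
    (he : ∀ a, IsLocallyConstant fun x => e x a) (hinj : Function.Injective e) {f : X → L}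
    (hf : IsLocallyConstant f) (hfe : ∀ x, ∃ a, e x a = f x) : ∃ a, ∀ x, e x a = f x := by
  have step : ∀ a x, ∃ b, e x b = f x ∧ ∀ y, e y a = f y → e y b = f y := by
    intro a x
    have hcl : IsClosed {y | e y a = f y} := by
      rw [← isOpen_compl_iff, isOpen_iff_eventually]
      intro y hy
      filter_upwards [(he a).eventually_eq y, hf.eventually_eq y] with z h1 h2
      change ¬ _ = _
      rwa [h1, h2]
    obtain ⟨c, hc⟩ := hfe x
    obtain ⟨b, hb, hb'⟩ := exists_eqOn_of_isCompact hm he (e x) a hcl.isCompact ⟨c, hc⟩ fun y hy => by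
      by_cases hxy : x = y
      · subst hxy
        exact ⟨a, hy, rfl⟩
      · obtain ⟨d, hd, hd'⟩ := hbin.exists_apply_eq (hinj.ne hxy) c a
        exact ⟨d, hd.trans hc, hd'⟩
    exact ⟨b, hb, fun y hy => (hb' y hy).trans hy⟩
  have join : ∀ a c, ∃ b, ∀ y, (e y a = f y ∨ e y c = f y) → e y b = f y := by
    intro a c
    suffices h : ∃ b, ∀ y, (e y a = f y ∨ (e y c = f y ∧ y ∈ Set.univ)) → e y b = f y by
      simpa using h
    refine isCompact_univ.induction_on
      (p := fun U => ∃ b, ∀ y, (e y a = f y ∨ (e y c = f y ∧ y ∈ U)) → e y b = f y) ?_ ?_ ?_ ?_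
    · exact ⟨a, by simp⟩
    · rintro s t hst ⟨b, hb⟩
      exact ⟨b, fun y hy => hb y (hy.imp_right fun h => ⟨h.1, hst h.2⟩)⟩
    · rintro s t ⟨b, hb⟩ ⟨b', hb'⟩
      -- Both `b` and `b'` keep the agreement of `a`; where `c` agrees with `f`, it is seconded by
      -- `b` on `s` and by `b'` on `t`.
      refine ⟨m.realize ![b, b', c], fun y hy => ?_⟩
      rw [hom_realize_three]
      rcases hy with hy | ⟨hc, hy | hy⟩
      · rw [hb y (.inl hy), hb' y (.inl hy), (hm _ _).1]
      · rw [hb y (.inr ⟨hc, hy⟩), hc, (hm _ _).2.1]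
      · rw [hb' y (.inr ⟨hc, hy⟩), hc, (hm _ _).2.2]
    · intro x _
      obtain ⟨b, hb, hb'⟩ := step a x
      refine ⟨{y | e y b = f y}, mem_nhdsWithin_of_mem_nhds ?_, b, fun y hy => ?_⟩
      · filter_upwards [(he b).eventually_eq x, hf.eventually_eq x] with y h1 h2
        rw [h1, h2, hb]
      · exact hy.elim (hb' y) fun h => h.2
  suffices h : ∃ b, ∀ y ∈ Set.univ, e y b = f y by simpa using h
  refine isCompact_univ.induction_on (p := fun U => ∃ b, ∀ y ∈ U, e y b = f y) ?_ ?_ ?_ ?_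
  · exact ⟨Classical.arbitrary A, by simp⟩
  · rintro s t hst ⟨b, hb⟩
    exact ⟨b, fun y hy => hb y (hst hy)⟩
  · rintro s t ⟨b, hb⟩ ⟨c, hc⟩
    obtain ⟨d, hd⟩ := join b c
    exact ⟨d, fun y hy => hd y (hy.imp (hb y) (hc y))⟩
  · intro x _
    obtain ⟨c, hc⟩ := hfe x
    refine ⟨{y | e y c = f y}, mem_nhdsWithin_of_mem_nhds ?_, c, fun _ hy => hy⟩
    filter_upwards [(he c).eventually_eq x, hf.eventually_eq x] with y h1 h2
    rw [h1, h2, hc]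

end Interpolation
end LDuality

namespace LDuality

open FirstOrder.Language Topology

/-! ### Unary constraints and their fibers -/

namespace UnaryConstraints

variable {S : FirstOrder.Language.{u, v}} {L : Type w} [S.Structure L] {X : Type w'}

/-- The unary constraints given by prescribing the fibers. -/
def ofFiber (B : X → S.Substructure L) : UnaryConstraints S L X := fun I _ =>
  { carrier := {f | ∀ x : I, f x ∈ B x}
    fun_mem := fun f a ha x => (B x).fun_mem f (fun i => a i x) fun i => ha i x }

theorem fiber_ofFiber (B : X → S.Substructure L) (x : X) : (ofFiber B).fiber x = B x := by
  ext a
  exact ⟨fun h => h ⟨x, rfl⟩, fun h => by rintro ⟨_, rfl⟩; exact h⟩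

theorem isSubdirect_ofFiber {B : X → S.Substructure L} (hB : ∀ x, (B x : Set L).Nonempty) :
    (ofFiber B).IsSubdirect := by
  classical
  intro I J hI hJ h g
  constructor
  · intro hg
    choose c hc using hB
    refine ⟨fun x => if hx : (x : X) ∈ J then g ⟨x, hx⟩ else c x, fun x => ?_, fun x => ?_⟩
    · dsimp only
      split_ifs with hx
      · exact hg ⟨x, hx⟩
      · exact hc x
    · simp
  · rintro ⟨f, hf, hfg⟩ x
    rw [hfg]
    exact hf (Set.inclusion h x)

theorem IsSubdirect.mem_iff {A : UnaryConstraints S L X} (hA : A.IsSubdirect)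
    (hS : Nonempty S.Constants) {I : Set X} {hI : I.Subsingleton} {f : I → L} :
    f ∈ A I hI ↔ ∀ x : I, f x ∈ A.fiber x := by
  have h1 : ∀ x : I, f x ∈ A.fiber x ↔ (fun y : ({x.1} : Set X) => f x) ∈ A {x.1}
    Set.subsingleton_singleton := fun x => Iff.rfl
  constructor
  · intro hf x
    have hx : ({x.1} : Set X) ⊆ I := by simp
    rw [h1, hA I {x.1} hI Set.subsingleton_singleton hx]
    refine ⟨f, hf, ?_⟩
    rintro ⟨_, rfl⟩
    rfl
  · intro hf
    rcases hI.eq_empty_or_singleton with rfl | ⟨x, rfl⟩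
    -- `L ^ ∅` has a single element, which lies in `A ∅` because it interprets a constant.
    · obtain ⟨c⟩ := hS
      exact Subsingleton.elim (c : (∅ : Set X) → L) f ▸ (A ∅ hI).constants_mem c
    · have := hf ⟨x, rfl⟩
      rw [h1] at this
      convert this with y
      exact Subtype.ext y.2

/-- The elements of `A_x` form a subalgebra. -/
def fiberSubstructure (A : UnaryConstraints S L X) (x : X) : S.Substructure L where
  carrier := A.fiber x
  fun_mem f a ha := (A {x} Set.subsingleton_singleton).fun_mem f (fun i _ => a i) ha

end UnaryConstraints

section

variable {S : FirstOrder.Language.{u, v}} {L : Type w} [S.Structure L]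

theorem UnarySpace.Hom.fiber_subset {X Y : UnarySpace S L} (φ : UnarySpace.Hom X Y) (x : X.carrier) :
    Y.constraint.fiber (φ.toFun x) ⊆ X.constraint.fiber x := by
  intro a ha
  refine φ.map_constraint {x} Set.subsingleton_singleton (fun _ => a) ?_
  exact Y.constraint.mem_congr (Set.image_singleton).symm _ _ _ ha

/-- A continuous map that shrinks fibers is a morphism if `≈` is equality on its domain. -/
def UnarySpace.Hom.ofFiber (hS : Nonempty S.Constants) {X Y : UnarySpace S L}
    (hX : ∀ x y, X.rel x y ↔ x = y) (φ : X.carrier → Y.carrier) (hφ : Continuous φ)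
    (h : ∀ x, Y.constraint.fiber (φ x) ⊆ X.constraint.fiber x) : UnarySpace.Hom X Y where
  toFun := φ
  continuous_toFun := hφ
  map_constraint I hI g hg := by
    rw [X.subdirect.mem_iff hS]
    rw [Y.subdirect.mem_iff hS] at hg
    exact fun x => h x (hg ⟨φ x, _⟩)
  map_rel x y hxy := by
    rw [(hX x y).1 hxy]

/-! ### The topology of the space of homomorphisms -/

/-- Homomorphisms carry the topology of pointwise convergence, for the discrete topology of `L`. -/
instance homTopology (A : Type w') [S.Structure A] : TopologicalSpace (A →[S] L) :=
  .induced (fun h : A →[S] L => (h : A → L)) (@Pi.topologicalSpace A (fun _ => L) fun _ => ⊥)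

theorem isLocallyConstant_apply {A : Type w'} [S.Structure A] (a : A) :
    IsLocallyConstant fun h : A →[S] L => h a := by
  let _ : TopologicalSpace L := ⊥
  have : DiscreteTopology L := ⟨rfl⟩
  rw [IsLocallyConstant.iff_continuous]
  exact (continuous_apply a).comp continuous_induced_dom

theorem continuous_hom_iff {A : Type w'} [S.Structure A] {X : Type*} [TopologicalSpace X]
    {e : X → (A →[S] L)} : Continuous e ↔ ∀ a, IsLocallyConstant fun x => e x a := by
  let _ : TopologicalSpace L := ⊥
  have : DiscreteTopology L := ⟨rfl⟩
  rw [continuous_induced_rng, continuous_pi_iff]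
  exact forall_congr' fun a => (IsLocallyConstant.iff_continuous _).symm

theorem isEmbedding_coe_hom (A : Type w') [S.Structure A] :
    letI : TopologicalSpace L := ⊥
    IsEmbedding (fun h : A →[S] L => (h : A → L)) := by
  let _ : TopologicalSpace L := ⊥
  exact ⟨⟨rfl⟩, DFunLike.coe_injective⟩

instance (A : Type w') [S.Structure A] : T2Space (A →[S] L) := by
  let _ : TopologicalSpace L := ⊥
  have : DiscreteTopology L := ⟨rfl⟩
  exact (isEmbedding_coe_hom A).t2Space

instance (A : Type w') [S.Structure A] : TotallyDisconnectedSpace (A →[S] L) := by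
  let _ : TopologicalSpace L := ⊥
  have : DiscreteTopology L := ⟨rfl⟩
  have h : IsEmbedding (fun h : A →[S] L => (h : A → L)) := isEmbedding_coe_hom A
  exact ⟨h.isTotallyDisconnected (isTotallyDisconnected_of_totallyDisconnectedSpace _)⟩

/-- Preserving one operation at one tuple is a closed condition on functions `A → L`. -/
theorem isClosed_range_coe_hom [S.IsAlgebraic] (A : Type w') [S.Structure A] :
    letI : TopologicalSpace L := ⊥
    IsClosed (Set.range fun h : A →[S] L => (h : A → L)) := by
  let _ : TopologicalSpace L := ⊥
  have : DiscreteTopology L := ⟨rfl⟩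
  have : (Set.range fun h : A →[S] L => (h : A → L)) = ⋂ (p : Σ n, S.Functions n × (Fin n → A)),
      {f : A → L | f (Structure.funMap p.2.1 p.2.2) = Structure.funMap p.2.1 (f ∘ p.2.2)} := by
    ext f
    simp only [Set.mem_range, Set.mem_iInter]
    constructor
    · rintro ⟨h, rfl⟩ p
      exact h.map_fun _ _
    · intro hf
      exact ⟨⟨f, fun {n} g x => hf ⟨n, g, x⟩, fun r => isEmptyElim r⟩, rfl⟩
  rw [this]
  refine isClosed_iInter fun p => isClosed_eq (continuous_apply _) ?_
  exact continuous_of_discreteTopology.comp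
    (continuous_pi fun i => continuous_apply (A := fun _ => L) (p.2.2 i))

/-- The closure `K` of the coordinate projections of `ρ` is compact, since it lies in a product of
finite sets. It separates points, so it contains every nonconstant homomorphism, and none is
constant as no range is a singleton. -/
theorem compactSpace_hom [S.IsAlgebraic] [Nontrivial L] (hS : Nonempty S.Constants)
    (hpartial : OnlyTrivialPartialEndomorphisms S L)
    {m : S.Term (Fin 3)} (hm : IsMajorityTerm L m)
    (hbin : OnlySubdiagonalOrProductSubalgebras S L) {A : Type w'} [S.Structure A] {X : Type*}
    (ρ : A ↪[S] (X → L)) (hρ : ∀ a, (Set.range (ρ a)).Finite) : CompactSpace (A →[S] L) := by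
  let _ : TopologicalSpace L := ⊥
  have : DiscreteTopology L := ⟨rfl⟩
  let e : X → (A →[S] L) := fun x => (evalHom S L x).comp ρ.toHom
  let K : Set (A →[S] L) := closure (Set.range e)
  have hemb : IsEmbedding (fun h : A →[S] L => (h : A → L)) := isEmbedding_coe_hom A
  have hcl : IsClosedEmbedding (fun h : A →[S] L => (h : A → L)) :=
    ⟨hemb, isClosed_range_coe_hom A⟩
  have hK : IsCompact K := by
    have hP : IsCompact (Set.univ.pi fun a => Set.range (ρ a)) :=
      isCompact_univ_pi fun a => (hρ a).isCompact
    refine (hcl.isCompact_preimage hP).of_isClosed_subset isClosed_closure ?_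
    refine closure_minimal ?_ (hP.isClosed.preimage hcl.continuous)
    rintro _ ⟨x, rfl⟩ a -
    exact ⟨x, rfl⟩
  have : CompactSpace K := isCompact_iff_compactSpace.1 hK
  have hKuniv : K = Set.univ := by
    refine Set.eq_univ_of_forall fun h => ?_
    have hne : ∃ a b, h a ≠ h b := by
      obtain ⟨c⟩ := hS
      obtain ⟨y, hyr, hy⟩ := hpartial.exists_mem_ne (B := h.range)
        ⟨_, h.mem_range_self c⟩ (h c)
      obtain ⟨a, rfl⟩ := Hom.mem_range.1 hyr
      exact ⟨a, c, hy⟩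
    obtain ⟨x, hx⟩ := exists_eq_of_separating hm hbin (X := K) (e := fun x => x.1)
      (fun a => (isLocallyConstant_apply a).comp_continuous continuous_subtype_val)
      (fun a b hab => ρ.injective <| funext fun x =>
        hab ⟨e x, subset_closure ⟨x, rfl⟩⟩) h hne
    exact hx ▸ x.2
  exact ⟨hKuniv ▸ hK⟩

end
end LDuality

namespace LDuality

open FirstOrder.Language Topology

/-! ### Standing assumptions and the algebra of sections -/

/-- The standing assumptions on `L`. -/
structure IsDualizing (S : FirstOrder.Language.{u, v}) (L : Type w) [S.Structure L] : Prop where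
  onlyTrivialPartialEndomorphisms : OnlyTrivialPartialEndomorphisms S L
  nonempty_constants : Nonempty S.Constants
  exists_isMajorityTerm : ∃ m : S.Term (Fin 3), IsMajorityTerm L m
  onlySubdiagonalOrProductSubalgebras : OnlySubdiagonalOrProductSubalgebras S L

section

variable {S : FirstOrder.Language.{u, v}} {L : Type w} [S.Structure L]

theorem IsDualizing.nonempty_substructure (H : IsDualizing S L) {A : Type w'} [S.Structure A]
    (B : S.Substructure A) : (B : Set A).Nonempty :=
  H.nonempty_constants.elim fun c => ⟨c, B.constants_mem c⟩

theorem IsFinitelyValued.eq_of_forall_hom {A : Alg.{u, v, w} S} (hA : IsFinitelyValued L A)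
    {a b : A.carrier} (h : ∀ h : A.carrier →[S] L, h a = h b) : a = b := by
  obtain ⟨X, ρ, -⟩ := hA
  exact ρ.injective (funext fun x => h ((evalHom S L x).comp ρ.toHom))

/-- The algebra of continuous sections of a unary space. -/
def sectionAlgebra (X : UnarySpace S L) : S.Substructure (X.carrier → L) where
  carrier := {f | IsLocallyConstant f ∧ ∀ x, f x ∈ X.constraint.fiber x}
  fun_mem g a ha := by
    refine ⟨?_, fun x => (X.constraint.fiberSubstructure x).fun_mem g (fun i => a i x)
      fun i => (ha i).2 x⟩
    rw [IsLocallyConstant.iff_eventually_eq]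
    intro x
    have := Filter.eventually_all.2 fun i => (ha i).1.eventually_eq x
    filter_upwards [this] with y hy
    exact congrArg (Structure.funMap g) (funext hy)

theorem isFinitelyValued_sectionAlgebra (X : UnarySpace S L) (hX : IsStone X.carrier) :
    IsFinitelyValued L (⟨sectionAlgebra X⟩ : Alg.{u, v, w} S) := by
  have := hX.1
  exact ⟨X.carrier, (sectionAlgebra X).subtype, fun f => f.2.1.range_finite⟩

/-- Evaluation of sections at a point. -/
def evalSection (X : UnarySpace S L) (x : X.carrier) : sectionAlgebra X →[S] L :=
  (evalHom S L x).comp (sectionAlgebra X).subtype.toHom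

/-- The value `a` is allowed on an open set, hence on a clopen neighbourhood of `x`; elsewhere a
constant serves as default, since it belongs to every fiber. -/
theorem exists_section (H : IsDualizing S L) {X : UnarySpace S L} (hX : IsStone X.carrier)
    {x : X.carrier} {a : L} (ha : a ∈ X.constraint.fiber x) {U : Set X.carrier} (hU : U ∈ 𝓝 x) :
    ∃ f : sectionAlgebra X, f.1 x = a ∧
      ∀ y ∉ U, f.1 y = (H.nonempty_constants.some : L) := by
  classical
  have hW : U ∩ {y | a ∈ X.constraint.fiber y} ∈ 𝓝 x :=
    Filter.inter_mem hU ((X.continuous.2 a).mem_nhds ha)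
  obtain ⟨V, hV, hxV, hVW⟩ := hX.2.2.mem_nhds_iff.1 hW
  refine ⟨⟨fun y => if y ∈ V then a else (H.nonempty_constants.some : L), ?_, fun y => ?_⟩,
    if_pos hxV, fun y hy => if_neg fun hyV => hy (hVW hyV).1⟩
  · rw [IsLocallyConstant.iff_eventually_eq]
    intro y
    by_cases hy : y ∈ V
    · filter_upwards [hV.isOpen.mem_nhds hy] with z hz
      simp [hy, hz]
    · filter_upwards [hV.compl.isOpen.mem_nhds hy] with z hz
      have hz' : z ∉ V := hz
      simp [hy, hz']
  · dsimp only
    split_ifs with hy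
    · exact (hVW hy).2
    · exact (X.constraint.fiberSubstructure y).constants_mem _

theorem continuous_evalSection (X : UnarySpace S L) : Continuous (evalSection X) :=
  continuous_hom_iff.2 fun f => f.2.1

/-! ### The dual functor, full and faithful -/

variable [S.IsAlgebraic] [Nontrivial L]

/-- The space of homomorphisms to `L`, with the range of `h` as the fiber at `h`. -/
def homSpace (H : IsDualizing S L) (A : Type w) [S.Structure A] : UnarySpace S L where
  carrier := A →[S] L
  constraint := UnaryConstraints.ofFiber fun h => h.range
  subdirect := UnaryConstraints.isSubdirect_ofFiber fun h => H.nonempty_substructure _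
  continuous := by
    refine ⟨fun I hI f _ => ?_, fun a => ?_⟩
    · have := hI.coe_sort
      exact IsLocallyConstant.of_constant f fun x y => congrArg f (Subsingleton.elim x y)
    · have : {h : A →[S] L | a ∈ (UnaryConstraints.ofFiber fun h : A →[S] L => h.range).fiber h} =
          ⋃ b : A, {h | h b = a} := by
        ext h
        rw [Set.mem_ofPred_eq, UnaryConstraints.fiber_ofFiber, SetLike.mem_coe, Hom.mem_range]
        simp
      rw [this]
      exact isOpen_iUnion fun b => (isLocallyConstant_apply b).isOpen_fiber a
  rel := ⊥
  closed := isClosed_diagonal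
  distinguish g h _ := by
    obtain ⟨b, hb⟩ := H.nonempty_substructure h.range
    -- The range of `g` has at least two elements, so it contains one different from `b`.
    obtain ⟨a, ha, hab⟩ := H.onlyTrivialPartialEndomorphisms.exists_mem_ne
      (H.nonempty_substructure g.range) b
    rw [UnaryConstraints.fiber_ofFiber, UnaryConstraints.fiber_ofFiber]
    exact ⟨a, ha, b, hb, hab⟩

theorem mem_fiber_homSpace (H : IsDualizing S L) {A : Type w} [S.Structure A]
    {h : A →[S] L} {a : L} : a ∈ (homSpace H A).constraint.fiber h ↔ ∃ b, h b = a := by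
  rw [← Hom.mem_range, ← SetLike.mem_coe]
  exact Set.ext_iff.1 (UnaryConstraints.fiber_ofFiber (fun h : A →[S] L => h.range) h) a

theorem isStone_of_totallyDisconnected (X : Type w) [TopologicalSpace X] [CompactSpace X]
    [T2Space X] [TotallyDisconnectedSpace X] : IsStone X :=
  ⟨inferInstance, inferInstance, isTopologicalBasis_isClopen⟩

theorem IsFinitelyValued.compactSpace_hom (H : IsDualizing S L) {A : Alg.{u, v, w} S}
    (hA : IsFinitelyValued L A) : CompactSpace (A.carrier →[S] L) := by
  obtain ⟨m, hm⟩ := H.exists_isMajorityTerm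
  obtain ⟨X, ρ, hρ⟩ := hA
  exact LDuality.compactSpace_hom H.nonempty_constants H.onlyTrivialPartialEndomorphisms hm
    H.onlySubdiagonalOrProductSubalgebras ρ hρ

theorem IsFinitelyValued.exists_eq_section (H : IsDualizing S L) {A : Alg.{u, v, w} S}
    (hA : IsFinitelyValued L A) {f : (A.carrier →[S] L) → L} (hf : IsLocallyConstant f)
    (hfe : ∀ h, ∃ a, h a = f h) : ∃ a, ∀ h, h a = f h := by
  have := hA.compactSpace_hom H
  obtain ⟨m, hm⟩ := H.exists_isMajorityTerm
  have : Nonempty A.carrier := H.nonempty_constants.elim fun c => ⟨(c : A.carrier)⟩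
  exact LDuality.exists_eq_section hm H.onlySubdiagonalOrProductSubalgebras (e := id)
    isLocallyConstant_apply Function.injective_id hf hfe

/-- Precomposition with a homomorphism. -/
def homSpaceMap (H : IsDualizing S L) {A B : Type w} [S.Structure A] [S.Structure B]
    (f : A →[S] B) : UnarySpace.Hom (homSpace H B) (homSpace H A) :=
  .ofFiber H.nonempty_constants (fun _ _ => Iff.rfl) (fun h => h.comp f)
    (continuous_hom_iff.2 fun a => isLocallyConstant_apply (f a)) fun h a ha => by
      obtain ⟨b, hb⟩ := (mem_fiber_homSpace H).1 ha
      exact (mem_fiber_homSpace H).2 ⟨f b, hb⟩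

/-- The functor `A ↦ Hom(A, L)`. -/
def dualFunctor (H : IsDualizing S L) : (FinitelyValuedAlg S L)ᵒᵖ ⥤ StoneUnarySpace S L where
  obj A := ⟨homSpace H A.unop.obj.carrier, by
    have := A.unop.property.compactSpace_hom H
    exact isStone_of_totallyDisconnected (A.unop.obj.carrier →[S] L), fun _ _ => Iff.rfl⟩
  map f := ObjectProperty.homMk (homSpaceMap H f.unop.hom)

instance (H : IsDualizing S L) : (dualFunctor H).Faithful where
  map_injective {A B} f g hfg := by
    refine Quiver.Hom.unop_inj (ObjectProperty.hom_ext _ (Hom.ext fun a => ?_))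
    refine A.unop.property.eq_of_forall_hom fun h => ?_
    have h1 : h.comp f.unop.hom = h.comp g.unop.hom :=
      congrArg (fun φ => UnarySpace.Hom.toFun φ.hom h) hfg
    exact DFunLike.congr_fun h1 a

/-- For fixed `a`, the function `h ↦ φ h a` is a locally constant section over the dual of `B`,
hence evaluation at some `b`, which becomes `f a`. Homomorphisms to `L` separate the points of `B`,
so `f` preserves the operations. -/
theorem exists_hom_of_spaceHom (H : IsDualizing S L) {A B : Alg.{u, v, w} S}
    (hB : IsFinitelyValued L B) (φ : UnarySpace.Hom (homSpace H B.carrier) (homSpace H A.carrier)) :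
    ∃ f : A.carrier →[S] B.carrier, ∀ h : B.carrier →[S] L, h.comp f = φ.toFun h := by
  let ψ : (B.carrier →[S] L) → (A.carrier →[S] L) := φ.toFun
  have key : ∀ a : A.carrier, ∃ b : B.carrier, ∀ h : B.carrier →[S] L, h b = ψ h a := by
    intro a
    refine hB.exists_eq_section H (continuous_hom_iff.1 φ.continuous_toFun a) fun h => ?_
    rw [← mem_fiber_homSpace H]
    exact φ.fiber_subset h ((mem_fiber_homSpace H).2 ⟨a, rfl⟩)
  choose f hf using key
  refine ⟨⟨f, fun g x => hB.eq_of_forall_hom fun h => ?_, fun r => isEmptyElim r⟩,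
    fun h => Hom.ext fun a => hf a h⟩
  rw [hf, Hom.map_fun, Hom.map_fun]
  congr 1
  ext i
  exact (hf _ h).symm

instance (H : IsDualizing S L) : (dualFunctor H).Full where
  map_surjective {A B} φ := by
    obtain ⟨f, hf⟩ := exists_hom_of_spaceHom H (A := B.unop.obj) (B := A.unop.obj)
      A.unop.property φ.hom
    let f' : B.unop ⟶ A.unop := ObjectProperty.homMk f
    exact ⟨f'.op, ObjectProperty.hom_ext _ (UnarySpace.Hom.ext (funext hf))⟩

/-! ### Stone separated spaces as duals of their section algebras -/

theorem injective_evalSection (H : IsDualizing S L) {X : UnarySpace S L} (hX : IsStone X.carrier) :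
    Function.Injective (evalSection X) := by
  have := hX.2.1
  intro x y hxy
  by_contra hne
  -- A value at `x` other than the default constant yields a section that tells `x` from `y`.
  obtain ⟨a, ha, hac⟩ := H.onlyTrivialPartialEndomorphisms.exists_mem_ne
    (H.nonempty_substructure (X.constraint.fiberSubstructure x)) (H.nonempty_constants.some : L)
  obtain ⟨f, hf, hf'⟩ := exists_section H hX ha (isOpen_compl_singleton.mem_nhds hne)
  have h1 : f.1 x = f.1 y := DFunLike.congr_fun hxy f
  exact hac (by rw [← hf, h1, hf' y (by simp)])

/-- Evaluations form a compact family separating sections, and `h` is not constant because its range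
is not a singleton. -/
theorem surjective_evalSection (H : IsDualizing S L) {X : UnarySpace S L}
    (hX : IsStone X.carrier) : Function.Surjective (evalSection X) := by
  have := hX.1
  obtain ⟨m, hm⟩ := H.exists_isMajorityTerm
  intro h
  refine exists_eq_of_separating hm H.onlySubdiagonalOrProductSubalgebras (e := evalSection X)
    (fun f => f.2.1) (fun f g hfg => Subtype.ext (funext hfg)) h ?_
  obtain ⟨b, hb⟩ := H.nonempty_substructure h.range
  obtain ⟨a, ha, hab⟩ := H.onlyTrivialPartialEndomorphisms.exists_mem_ne
    (H.nonempty_substructure h.range) b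
  obtain ⟨b, rfl⟩ := Hom.mem_range.1 hb
  obtain ⟨a, rfl⟩ := Hom.mem_range.1 ha
  exact ⟨a, b, hab⟩

theorem fiber_homSpace_evalSection (H : IsDualizing S L) {X : UnarySpace S L}
    (hX : IsStone X.carrier) (x : X.carrier) :
    (homSpace H (sectionAlgebra X)).constraint.fiber (evalSection X x) = X.constraint.fiber x := by
  ext a
  rw [mem_fiber_homSpace]
  constructor
  · rintro ⟨f, rfl⟩
    exact f.2.2 x
  · intro ha
    obtain ⟨f, hf, -⟩ := exists_section H hX ha Filter.univ_mem
    exact ⟨f, hf⟩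

/-- A Stone separated space is isomorphic to the dual of its algebra of sections. -/
noncomputable def evalIso (H : IsDualizing S L) {X : UnarySpace S L} (hX : IsStoneSeparated S L X) :
    X ≅ homSpace H (sectionAlgebra X) :=
  let E : X.carrier ≃ (sectionAlgebra X →[S] L) := Equiv.ofBijective (evalSection X)
    ⟨injective_evalSection H hX.1, surjective_evalSection H hX.1⟩
  { hom := UnarySpace.Hom.ofFiber H.nonempty_constants (Y := homSpace H (sectionAlgebra X)) hX.2
      (evalSection X) (continuous_evalSection X)
      fun x => (fiber_homSpace_evalSection H hX.1 x).subset
    inv := UnarySpace.Hom.ofFiber H.nonempty_constants (X := homSpace H (sectionAlgebra X))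
      (fun _ _ => Iff.rfl) E.symm
      (by
        have := hX.1.1
        -- A continuous bijection from a compact space to a Hausdorff space is a homeomorphism.
        exact Continuous.continuous_symm_of_equiv_compact_to_t2 (f := E)
          (continuous_evalSection X))
      fun h => by
        obtain ⟨x, rfl⟩ := E.surjective h
        rw [E.symm_apply_apply]
        exact (fiber_homSpace_evalSection H hX.1 x).superset
    hom_inv_id := UnarySpace.Hom.ext (funext E.symm_apply_apply)
    inv_hom_id := UnarySpace.Hom.ext (funext E.apply_symm_apply) }

instance (H : IsDualizing S L) : (dualFunctor H).EssSurj where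
  mem_essImage X :=
    ⟨.op ⟨⟨sectionAlgebra X.obj⟩, isFinitelyValued_sectionAlgebra X.obj X.property.1⟩,
      ⟨(ObjectProperty.isoMk _ (evalIso H X.property)).symm⟩⟩

end
end LDuality

theorem mainTheorem4 (S : FirstOrder.Language.{u, v}) [S.IsAlgebraic]
    (L : Type w) [S.Structure L] [Nontrivial L]
    (hpartial : LDuality.OnlyTrivialPartialEndomorphisms S L)
    (hempty : LDuality.NoEmptySubalgebra S L)
    (hmajority : ∃ m : S.Term (Fin 3), LDuality.IsMajorityTerm L m)
    (hbinary : LDuality.OnlySubdiagonalOrProductSubalgebras S L) :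
    Nonempty ((LDuality.FinitelyValuedAlg S L)ᵒᵖ ≌ LDuality.StoneUnarySpace S L) := by
  have H : LDuality.IsDualizing S L := ⟨hpartial, hempty.nonempty_constants, hmajority, hbinary⟩
  have : (LDuality.dualFunctor H).IsEquivalence := { }
  exact ⟨(LDuality.dualFunctor H).asEquivalence⟩
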